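/- Let $G=(V,E)$ be a 2-vertex-connected simple graph with $n\ge 2$ vertices (i.e. $G$ is connected and remains connected after deleting any one vertex). Let $LP(G)$ be the linear program \[ \min \sum_{e\in E} x_e \quad\text{subject to}\quad \sum_{e\in\delta(S)} x_e \ge 2 \ \text{ for all } \emptyset\ne S\subsetneq V,\qquad x_e\ge 0 \ (e\in E), \] where $\delta(S)$ is the set of edges between $S$ and $V\setminus S$, and let $\mathrm{OPT}_{LP}$ be its optimal value. Let $x^*$ be an extreme optimal solution of $LP(G)$ (an optimal solution that is an extreme point of the feasible region), and assume that $x^*_e>0$ for every $e\in E$. Let $T$ be a DFS spanning tree of $G$, with an arbitrary root $r$, produced by a depth-first search which from the current vertex always follows an edge of highest $x^*$-value among the edges to unvisited vertices (ties broken arbitrarily). Direct the tree edges away from $r$ (tree-arcs) and all other edges towards $r$ (back-arcs). The network $C(G,T)$ is obtained as follows: for every non-root vertex $v$ with children $w_1,\dots,w_l$ in $T$, add new vertices $v_1,\dots,v_l$, replace each tree-arc $(v,w_j)$ by the tree-arcs $(v,v_j)$ and $(v_j,w_j)$, and redirect to $v_j$ every back-arc entering $v$ from the subtree rooted at $w_j$.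 Let $\mathcal I$ consist of the new vertices and the root, and for $v\in\mathcal I$ let $B(v)$ be the set of back-arcs entering $v$. The cost of a circulation $f$ is \[ |f|=\sum_{v\in\mathcal I}\max\bigl(f(B(v))-1,\,0\bigr),\qquad f(B(v))=\sum_{a\in B(v)}f(a). \] Let $f'$ be the circulation in $C(G,T)$ that is the sum, over all back-arcs $a$, of a flow of size $\min(x^*_a,1)$ along the unique cycle formed by $a$ and tree-arcs, where $x^*_a$ is the value of $x^*$ on the edge of $G$ corresponding to $a$. Then \[ |f'|\le \tfrac53\,\mathrm{OPT}_{LP}-\tfrac32\,n. \] -/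

import Mathlib

/-! ### Graphs and the subtour elimination linear program

Solutions are vectors indexed by unordered pairs that vanish outside the edge set, i.e. vectors
indexed by the edges, extended by zero. -/

/-- 2-vertex-connectivity: at least two vertices, connected, and still connected after the deletion
of any single vertex. (The graph with two vertices and one edge is allowed.) -/
def IsTwoVertexConnected {V : Type*} [Fintype V] (G : SimpleGraph V) : Prop :=
  2 ≤ Fintype.card V ∧ G.Connected ∧ ∀ v : V, (G.induce ({v}ᶜ : Set V)).Connected

open scoped Classical in
/-- `δ(S)`: the edges of `G` between `S` and its complement. -/
noncomputable def edgeCut {V : Type*} [Fintype V] (G : SimpleGraph V) (S : Set V) :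
    Finset (Sym2 V) :=
  Finset.univ.filter fun e => e ∈ G.edgeSet ∧ ∃ u ∈ S, ∃ v ∉ S, e = s(u, v)

/-- The feasible region of `LP(G)`. -/
def heldKarpFeasible {V : Type*} [Fintype V] (G : SimpleGraph V) : Set (Sym2 V → ℝ) :=
  {x | (∀ e, 0 ≤ x e) ∧ (∀ e, e ∉ G.edgeSet → x e = 0) ∧
    ∀ S : Set V, S.Nonempty → S ≠ Set.univ → 2 ≤ ∑ e ∈ edgeCut G S, x e}

open scoped Classical in
/-- The objective `∑_{e ∈ E} x_e` of `LP(G)`. -/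
noncomputable def lpValue {V : Type*} [Fintype V] (G : SimpleGraph V) (x : Sym2 V → ℝ) : ℝ :=
  ∑ e ∈ G.edgeFinset, x e

/-- `OPT_LP(G)`, the optimal value of `LP(G)`. -/
noncomputable def optLP {V : Type*} [Fintype V] (G : SimpleGraph V) : ℝ :=
  sInf (lpValue G '' heldKarpFeasible G)

/-- `x` is an extreme optimal solution of `LP(G)`: a vertex of the feasible polyhedron at which the
objective is minimal. -/
def IsExtremeOptimal {V : Type*} [Fintype V] (G : SimpleGraph V) (x : Sym2 V → ℝ) : Prop :=
  x ∈ (heldKarpFeasible G).extremePoints ℝ ∧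
    ∀ y ∈ heldKarpFeasible G, lpValue G x ≤ lpValue G y

/-! ### Depth-first search that follows the heaviest edge -/

/-- `GreedyDFS G x r s U A`: a depth-first search of `G` from `r` which always follows an edge of
highest `x`-value can reach the state with stack `s` (the current vertex first), set `U` of visited
vertices and set `A` of tree-arcs found so far, directed away from `r`. Ties are broken
arbitrarily. -/
inductive GreedyDFS {V : Type*} (G : SimpleGraph V) (x : Sym2 V → ℝ) (r : V) :
    List V → Set V → Set (V × V) → Prop
  | start : GreedyDFS G x r [r] {r} ∅
  | forward {v w : V} {s : List V} {U : Set V} {A : Set (V × V)} :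
      GreedyDFS G x r (v :: s) U A → G.Adj v w → w ∉ U →
      (∀ w', G.Adj v w' → w' ∉ U → x s(v, w') ≤ x s(v, w)) →
      GreedyDFS G x r (w :: v :: s) (insert w U) (insert (v, w) A)
  | backtrack {v : V} {s : List V} {U : Set V} {A : Set (V × V)} :
      GreedyDFS G x r (v :: s) U A → (∀ w, G.Adj v w → w ∈ U) → GreedyDFS G x r s U A

/-- `A` is the set of arcs of a DFS tree of `G` with root `r`, directed away from the root,
that results from always following an edge with the highest value of `x`. -/
def IsGreedyDFSTree {V : Type*} (G : SimpleGraph V) (x : Sym2 V → ℝ) (r : V)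
    (A : Set (V × V)) : Prop :=
  ∃ U : Set V, GreedyDFS G x r [] U A

/-! ### The circulation network

`A` is the set of arcs of a rooted tree with root `r`, directed away from `r`. -/

/-- There is a (possibly empty) directed path from `p` to `q` with arcs in `A`. If `A` is a rooted
tree, this says that `q` lies in the subtree rooted at `p`. -/
def ArcReach {N : Type*} (A : Set (N × N)) (p q : N) : Prop :=
  Relation.ReflTransGen (fun a b => (a, b) ∈ A) p q

/-- Vertices of the network: `Sum.inl v` is the vertex `v` of `G`, and `Sum.inr (v, w)` is the new
vertex placed on the tree-arc from a non-root vertex `v` to its child `w` (pairs `(v, w)` which are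
not of this kind do not occur in the network). -/
abbrev NetVertex (V : Type*) := V ⊕ (V × V)

/-- The vertex of `G` whose gadget contains a given vertex of the network. -/
def NetVertex.base {V : Type*} : NetVertex V → V :=
  Sum.elim id Prod.fst

open scoped Classical in
/-- The in-vertices: the root and all new vertices. -/
noncomputable def inVertices {V : Type*} [Fintype V] (r : V) (A : Set (V × V)) :
    Finset (NetVertex V) :=
  Finset.univ.filter fun p =>
    p = Sum.inl r ∨ ∃ v w, (v, w) ∈ A ∧ v ≠ r ∧ p = Sum.inr (v, w)

/-- The tree-arcs of the network. -/
def netTreeArcs {V : Type*} (r : V) (A : Set (V × V)) : Set (NetVertex V × NetVertex V) :=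
  {c | (∃ w, (r, w) ∈ A ∧ c = (Sum.inl r, Sum.inl w)) ∨
    ∃ v w, (v, w) ∈ A ∧ v ≠ r ∧
      (c = (Sum.inl v, Sum.inr (v, w)) ∨ c = (Sum.inr (v, w), Sum.inl w))}

/-- `(u, v)` is a back-arc of the directed graph: an edge of `G` that is not an edge of the tree,
directed towards the root, i.e. from a vertex `u` to an ancestor `v` of `u`. -/
def IsBackArc {V : Type*} (G : SimpleGraph V) (A : Set (V × V)) (u v : V) : Prop :=
  G.Adj u v ∧ (u, v) ∉ A ∧ (v, u) ∉ A ∧ ArcReach A v u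

open scoped Classical in
/-- The back-arcs of the network: a back-arc `(u, r)` is kept, and a back-arc `(u, v)` with `v ≠ r`
is redirected to the new vertex of `v` that belongs to the child `w` whose subtree contains `u`. -/
noncomputable def netBackArcs {V : Type*} [Fintype V] (G : SimpleGraph V) (r : V)
    (A : Set (V × V)) : Finset (NetVertex V × NetVertex V) :=
  Finset.univ.filter fun c =>
    (∃ u, IsBackArc G A u r ∧ c = (Sum.inl u, Sum.inl r)) ∨
    ∃ u v w, IsBackArc G A u v ∧ v ≠ r ∧ (v, w) ∈ A ∧ ArcReach A w u ∧
      c = (Sum.inl u, Sum.inr (v, w))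

/-- The edge of `G` to which a back-arc of the network corresponds. -/
def backArcEdge {V : Type*} (c : NetVertex V × NetVertex V) : Sym2 V :=
  s(c.1.base, c.2.base)

/-- The arcs of the fundamental cycle of a back-arc `a` of the network: `a` itself, and the
tree-arcs on the tree path from the head of `a` to the tail of `a`. -/
def fundamentalCycle {V : Type*} (r : V) (A : Set (V × V)) (a : NetVertex V × NetVertex V) :
    Set (NetVertex V × NetVertex V) :=
  {c | c = a ∨ (c ∈ netTreeArcs r A ∧ ArcReach (netTreeArcs r A) a.2 c.1 ∧
    ArcReach (netTreeArcs r A) c.2 a.1)}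

open scoped Classical in
/-- The cost `∑_{v ∈ I} max (f(B(v)) - 1, 0)` of a circulation `f`, where `I` is the set of
in-vertices and `B(v)` is the set of back-arcs entering `v`. -/
noncomputable def circulationCost {V : Type*} [Fintype V] (G : SimpleGraph V) (r : V)
    (A : Set (V × V)) (f : NetVertex V × NetVertex V → ℝ) : ℝ :=
  ∑ p ∈ inVertices r A, max ((∑ a ∈ netBackArcs G r A with a.2 = p, f a) - 1) 0

open scoped Classical in
/-- The core circulation `f'`: for each back-arc `a`, send flow `min (x_a, 1)` along the
fundamental cycle of `a`. -/
noncomputable def coreCirculation {V : Type*} [Fintype V] (G : SimpleGraph V) (x : Sym2 V → ℝ)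
    (r : V) (A : Set (V × V)) : NetVertex V × NetVertex V → ℝ :=
  fun c => ∑ a ∈ netBackArcs G r A,
    if c ∈ fundamentalCycle r A a then min (x (backArcEdge a)) 1 else 0

/-! The cost is bounded separately at each vertex `v` of `G`. If `k` back-arcs enter an in-vertex of
`v`, with truncated flow `B`, then some tree-arc out of `v` has value `T` at least that of each of
them, because the search preferred it. Hence `B ≤ k`, `B ≤ k * T`, and `B + T` is at most the LP
value `Y` of these edges, all of them incident to `v`. Elementary arithmetic (`excess_le`) gives an
excess of at most `5/6 * max (Y - 2) 0 + k/6`. The edge sets for different in-vertices of `v` are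
disjoint, so these bounds add up to `5/6 * (x(δ(v)) - 2)` plus a sixth of the number of back-arcs
entering the gadget (`sum_excess_le`). Summing over `v` gives `5/3 * OPT - 5/3 * n` plus a sixth of
the number of back-arcs. That number is below `n`: an extreme point has at most `2n - 2` positive
coordinates (`card_edgeFinset_le_of_extreme`, by uncrossing tight cuts), and `n - 1` edges lie in
the tree. -/

/-! ### Spanning sets for modular maps on intersecting families -/

open Finset in
/-- A modular map on an intersecting family of nonempty sets has a small spanning set: the values
at singletons together with fewer further vectors than there are points. -/
theorem exists_spanning_of_intersecting.{u, w} {M : Type w} [AddCommGroup M] [Module ℝ M] (n : ℕ) :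
    ∀ (B : Type u) [Fintype B] [Nonempty B], Fintype.card B = n →
    ∀ (F : Set (Set B)) (φ : Set B → M), (∀ S ∈ F, S.Nonempty) →
    (∀ S ∈ F, ∀ T ∈ F, (S ∩ T).Nonempty →
      S ∩ T ∈ F ∧ S ∪ T ∈ F ∧ φ S + φ T = φ (S ∩ T) + φ (S ∪ T)) →
    ∃ s : Finset M, s.card + 1 ≤ n ∧
      ∀ S ∈ F, φ S ∈ Submodule.span ℝ ((s : Set M) ∪ {m | ∃ v, {v} ∈ F ∧ φ {v} = m}) := by
  classical
  induction n using Nat.strong_induction_on with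
  | _ n ih =>
  intro B _ _ hB F φ hne hF
  by_cases hT : ∃ T ∈ F, T.Nontrivial
  -- Contract an inclusion-minimal non-singleton member `T` to the point `t₀` and induct; the lost
  -- point `t₁` pays for the extra vector `φ T`.
  · obtain ⟨T, ⟨hTF, hTn⟩, hTmin⟩ :=
      (Set.toFinite {T | T ∈ F ∧ T.Nontrivial}).exists_minimal hT
    obtain ⟨t₀, ht₀, t₁, ht₁, h01⟩ := hTn
    let B' := {b : B // b ∉ T ∨ b = t₀}
    let q : B → B' := fun b => if h : b ∈ T then ⟨t₀, Or.inr rfl⟩ else ⟨b, Or.inl h⟩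
    have hqT : ∀ b ∈ T, q b = ⟨t₀, Or.inr rfl⟩ := fun b hb => dif_pos hb
    have hqN : ∀ b (hb : b ∉ T), q b = ⟨b, Or.inl hb⟩ := fun b hb => dif_neg hb
    have hqs : Function.Surjective q := by
      rintro ⟨b, hb⟩
      rcases hb with hb | rfl
      · exact ⟨b, hqN b hb⟩
      · exact ⟨b, hqT b ht₀⟩
    have hmk : ∀ a b ha hb, (⟨a, ha⟩ : B') = ⟨b, hb⟩ ↔ a = b := fun a b ha hb => Subtype.mk_eq_mk
    have : Nonempty B' := ⟨⟨t₀, Or.inr rfl⟩⟩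
    have hcard : Fintype.card B' < n := by
      rw [← hB]
      exact Fintype.card_subtype_lt (x := t₁) (by simp [ht₁, h01.symm])
    -- Sets that do not split `T` are unions of fibres of `q`, so they survive the contraction.
    have hgood : ∀ S, T ⊆ S ∨ Disjoint S T → q ⁻¹' {b | b.1 ∈ S} = S := by
      intro S hS
      ext b
      by_cases hb : b ∈ T
      · simp only [Set.mem_preimage, Set.mem_ofPred_eq, hqT b hb]
        rcases hS with hS | hS
        · exact iff_of_true (hS ht₀) (hS hb)
        · exact iff_of_false (fun h => Set.disjoint_left.1 hS h ht₀)
            (fun h => Set.disjoint_left.1 hS h hb)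
      · simp [hqN b hb]
    obtain ⟨s, hs, hspan⟩ := ih _ hcard B' rfl {S | q ⁻¹' S ∈ F} (fun S => φ (q ⁻¹' S))
      (fun S hS => by
        obtain ⟨b, hb⟩ := hne _ hS
        exact ⟨q b, hb⟩)
      (fun S hS S' hS' hSS' => hF _ hS _ hS' (by
        obtain ⟨b, hb⟩ := hSS'
        obtain ⟨a, rfl⟩ := hqs b
        exact ⟨a, hb⟩))
    set W := Submodule.span ℝ
      (((insert (φ T) s : Finset M) : Set M) ∪ {m | ∃ v, {v} ∈ F ∧ φ {v} = m}) with hW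
    have hTW : φ T ∈ W := Submodule.subset_span (by simp)
    have hle : ∀ S ∈ F, T ⊆ S ∨ Disjoint S T → φ S ∈ W := by
      intro S hS hST
      have h1 := hspan {b | b.1 ∈ S} (by
        rw [Set.mem_ofPred_eq, hgood S hST]
        exact hS)
      simp only [hgood S hST] at h1
      refine (Submodule.span_le.2 ?_) h1
      rintro m (hm | ⟨⟨v, hv⟩, hvF, rfl⟩)
      · exact Submodule.subset_span (by simp [Finset.mem_coe.1 hm])
      · by_cases hvT : v = t₀
        · subst hvT
          have : q ⁻¹' {⟨v, hv⟩} = T := by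
            ext b
            by_cases hb : b ∈ T
            · simp [hqT b hb, hb]
            · simp only [Set.mem_preimage, hqN b hb, Set.mem_singleton_iff, hmk, hb,
                iff_false]
              rintro rfl
              exact hb ht₀
          simp only [this]
          exact hTW
        · have hvT' : v ∉ T := by tauto
          have : q ⁻¹' {⟨v, hv⟩} = {v} := by
            ext b
            by_cases hb : b ∈ T
            · simp only [Set.mem_preimage, hqT b hb, Set.mem_singleton_iff, hmk]
              exact iff_of_false (Ne.symm hvT) (fun h => hvT' (h ▸ hb))
            · simp [hqN b hb, hmk]
          rw [Set.mem_ofPred_eq, this] at hvF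
          simp only [this]
          exact Submodule.subset_span (Or.inr ⟨v, hvF, rfl⟩)
    refine ⟨insert (φ T) s, ?_, ?_⟩
    · have := Finset.card_insert_le (φ T) s
      omega
    · intro S hS
      -- If `S` meets `T`, minimality forces `S ∩ T` to be `T` or a singleton; in the latter case
      -- modularity trades `S` for `S ∪ T`, which contains `T`.
      by_cases hST : (S ∩ T).Nonempty
      · obtain ⟨hi, hu, hmod⟩ := hF S hS T hTF hST
        by_cases hn : (S ∩ T).Nontrivial
        · exact hle S hS (Or.inl ((hTmin ⟨hi, hn⟩ Set.inter_subset_right).trans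
            Set.inter_subset_left))
        · obtain ⟨v, hv⟩ := hST
          have hv' : S ∩ T = {v} := (Set.not_nontrivial_iff.1 hn).eq_singleton_of_mem hv
          have : φ S = φ {v} + φ (S ∪ T) - φ T := by
            rw [← hv', ← hmod]
            abel
          rw [this]
          refine sub_mem (add_mem (Submodule.subset_span (Or.inr ⟨v, hv' ▸ hi, rfl⟩)) ?_) hTW
          exact hle _ hu (Or.inl Set.subset_union_right)
      · exact hle S hS (Or.inr (Set.disjoint_iff_inter_eq_empty.2
          (Set.not_nonempty_iff_eq_empty.1 hST)))
  · refine ⟨∅, ?_, ?_⟩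
    · have := Fintype.card_pos (α := B)
      simp
      omega
    · intro S hS
      obtain ⟨v, hv⟩ := hne S hS
      have : S = {v} :=
        (Set.not_nontrivial_iff.1 fun h => hT ⟨S, hS, h⟩).eq_singleton_of_mem hv
      subst this
      exact Submodule.subset_span (Or.inr ⟨v, hS, rfl⟩)

/-! ### Tight cuts and the support of an extreme point -/

section CutLP

open Finset

variable {V : Type*} [Fintype V] {G : SimpleGraph V}

theorem mk_mem_edgeCut {S : Set V} {a b : V} :
    s(a, b) ∈ edgeCut G S ↔ G.Adj a b ∧ (a ∈ S ∧ b ∉ S ∨ b ∈ S ∧ a ∉ S) := by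
  classical
  simp only [edgeCut, mem_filter, mem_univ, true_and, SimpleGraph.mem_edgeSet, Sym2.eq_iff]
  refine and_congr_right fun _ => ⟨?_, ?_⟩
  · rintro ⟨u, hu, v, hv, ⟨rfl, rfl⟩ | ⟨rfl, rfl⟩⟩
    exacts [Or.inl ⟨hu, hv⟩, Or.inr ⟨hu, hv⟩]
  · rintro (⟨h1, h2⟩ | ⟨h1, h2⟩)
    exacts [⟨a, h1, b, h2, Or.inl ⟨rfl, rfl⟩⟩, ⟨b, h1, a, h2, Or.inr ⟨rfl, rfl⟩⟩]

theorem edgeSet_of_mem_edgeCut {S : Set V} {e : Sym2 V} (he : e ∈ edgeCut G S) :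
    e ∈ G.edgeSet := by
  classical
  exact (mem_filter.1 he).2.1

theorem edgeCut_compl (S : Set V) : edgeCut G Sᶜ = edgeCut G S := by
  ext e
  induction e with
  | _ a b =>
    simp only [mk_mem_edgeCut, Set.mem_compl_iff, not_not]
    tauto

/-- The indicator vector of `δ(S)`. -/
noncomputable def cutVector (G : SimpleGraph V) (S : Set V) : Sym2 V → ℝ :=
  Set.indicator (edgeCut G S : Set (Sym2 V)) 1

theorem sum_edgeCut_eq (S : Set V) (d : Sym2 V → ℝ) :
    ∑ e ∈ edgeCut G S, d e = ∑ e, cutVector G S e * d e := by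
  classical
  simp [cutVector, Set.indicator_apply, Finset.sum_ite_mem]

theorem cutVector_submodular (S T : Set V) (e : Sym2 V) :
    cutVector G (S ∩ T) e + cutVector G (S ∪ T) e ≤ cutVector G S e + cutVector G T e := by
  classical
  induction e with
  | _ a b =>
    simp only [cutVector, Set.indicator_apply, mem_coe, mk_mem_edgeCut, Set.mem_inter_iff,
      Set.mem_union, Pi.one_apply]
    by_cases h : G.Adj a b <;> by_cases h1 : a ∈ S <;> by_cases h2 : b ∈ S <;>
      by_cases h3 : a ∈ T <;> by_cases h4 : b ∈ T <;> simp [h, h1, h2, h3, h4]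

/-- Uncrossing of tight cuts. -/
theorem cutVector_modular {x : Sym2 V → ℝ} (hx : x ∈ heldKarpFeasible G)
    (hpos : ∀ e ∈ G.edgeSet, 0 < x e) {S T : Set V}
    (hS : ∑ e ∈ edgeCut G S, x e = 2) (hT : ∑ e ∈ edgeCut G T, x e = 2)
    (hi : (S ∩ T).Nonempty) (hu : S ∪ T ≠ Set.univ) :
    ∑ e ∈ edgeCut G (S ∩ T), x e = 2 ∧ ∑ e ∈ edgeCut G (S ∪ T), x e = 2 ∧
      cutVector G S + cutVector G T = cutVector G (S ∩ T) + cutVector G (S ∪ T) := by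
  classical
  have h1 := hx.2.2 (S ∩ T) hi (fun h => hu (Set.univ_subset_iff.1
    (h ▸ Set.inter_subset_left.trans Set.subset_union_left)))
  have h2 := hx.2.2 (S ∪ T) (hi.mono (Set.inter_subset_left.trans Set.subset_union_left)) hu
  have hnn : ∀ e ∈ univ, 0 ≤ (cutVector G S e + cutVector G T e -
      (cutVector G (S ∩ T) e + cutVector G (S ∪ T) e)) * x e := fun e _ =>
    mul_nonneg (sub_nonneg.2 (cutVector_submodular S T e)) (hx.1 e)
  have hsum : ∑ e, (cutVector G S e + cutVector G T e -
      (cutVector G (S ∩ T) e + cutVector G (S ∪ T) e)) * x e =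
      ∑ e ∈ edgeCut G S, x e + ∑ e ∈ edgeCut G T, x e -
      (∑ e ∈ edgeCut G (S ∩ T), x e + ∑ e ∈ edgeCut G (S ∪ T), x e) := by
    simp only [sum_edgeCut_eq, sub_mul, add_mul, sum_sub_distrib, sum_add_distrib]
  have h0 := sum_nonneg hnn
  refine ⟨by linarith, by linarith, ?_⟩
  -- Both new cuts have value at least 2 and the old ones exactly 2, so every submodularity gap
  -- weighted by `x` vanishes; positivity of `x` on edges then removes the weight.
  have hz := (sum_eq_zero_iff_of_nonneg hnn).1 (by linarith)
  funext e
  by_cases he : e ∈ G.edgeSet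
  · have := (mul_eq_zero.1 (hz e (mem_univ e))).resolve_right (hpos e he).ne'
    simp only [Pi.add_apply]
    linarith
  · have hc : ∀ S : Set V, cutVector G S e = 0 := fun S =>
      Set.indicator_of_notMem (fun h => he (edgeSet_of_mem_edgeCut (mem_coe.1 h))) _
    simp [hc]

/-- Vectors that annihilate all tight cuts vanish at an extreme point. -/
theorem eq_zero_of_extreme {x d : Sym2 V → ℝ} (hx : x ∈ (heldKarpFeasible G).extremePoints ℝ)
    (hpos : ∀ e ∈ G.edgeSet, 0 < x e) (hd : ∀ e ∉ G.edgeSet, d e = 0)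
    (htight : ∀ S : Set V, S.Nonempty → S ≠ Set.univ → ∑ e ∈ edgeCut G S, x e = 2 →
      ∑ e ∈ edgeCut G S, d e = 0) : d = 0 := by
  classical
  have key : ∀ a b : ℝ, 0 < a → ∀ᶠ ε : ℝ in nhdsWithin 0 (Set.Ioi 0), ε * |b| < a := by
    intro a b ha
    have : Filter.Tendsto (fun ε : ℝ => ε * |b|) (nhdsWithin 0 (Set.Ioi 0)) (nhds (0 * |b|)) :=
      ((continuous_id.mul continuous_const).tendsto 0).mono_left nhdsWithin_le_nhds
    exact this.eventually_lt_const (by simpa using ha)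
  have h1 : ∀ᶠ ε : ℝ in nhdsWithin 0 (Set.Ioi 0), ∀ e, e ∈ G.edgeSet → ε * |d e| < x e :=
    Filter.eventually_all.2 fun e => by
      by_cases he : e ∈ G.edgeSet
      · filter_upwards [key _ (d e) (hpos e he)] with ε hε _ using hε
      · simp [he]
  have h2 : ∀ᶠ ε : ℝ in nhdsWithin 0 (Set.Ioi 0), ∀ S : Set V, S.Nonempty → S ≠ Set.univ →
      ∑ e ∈ edgeCut G S, x e ≠ 2 →
      ε * |∑ e ∈ edgeCut G S, d e| < ∑ e ∈ edgeCut G S, x e - 2 :=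
    Filter.eventually_all.2 fun S => by
      by_cases h : S.Nonempty ∧ S ≠ Set.univ ∧ ∑ e ∈ edgeCut G S, x e ≠ 2
      · have := lt_of_le_of_ne (hx.1.2.2 S h.1 h.2.1) (Ne.symm h.2.2)
        filter_upwards [key _ (∑ e ∈ edgeCut G S, d e) (sub_pos.2 this)] with ε hε _ _ _ using hε
      · filter_upwards with ε a b c
        exact absurd ⟨a, b, c⟩ h
  obtain ⟨ε, ⟨hε1, hε2⟩, hε⟩ := ((h1.and h2).and self_mem_nhdsWithin).exists
  have hε : 0 < ε := hε
  -- `x` is the midpoint of `x + ε d` and `x - ε d`. Only finitely many constraints are slack, so a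
  -- small `ε` respects them, and tight cuts do not change.
  have hfeas : ∀ σ : ℝ, |σ| = 1 → (fun e => x e + σ * (ε * d e)) ∈ heldKarpFeasible G := by
    intro σ hσ
    have hb : ∀ b : ℝ, -(ε * |b|) ≤ σ * (ε * b) := fun b => by
      have := neg_abs_le (σ * (ε * b))
      rwa [abs_mul, abs_mul, hσ, abs_of_pos hε, one_mul] at this
    refine ⟨fun e => ?_, fun e he => ?_, fun S hS hS' => ?_⟩
    · by_cases he : e ∈ G.edgeSet
      · linarith [hε1 e he, hb (d e)]
      · simp [hd e he, hx.1.1 e]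
    · simp [hd e he, hx.1.2.1 e he]
    · rw [sum_add_distrib, ← mul_sum, ← mul_sum]
      by_cases h : ∑ e ∈ edgeCut G S, x e = 2
      · simp [htight S hS hS' h, h]
      · linarith [hε2 S hS hS' h, hb (∑ e ∈ edgeCut G S, d e)]
  have := hx.2 (hfeas 1 (by simp)) (hfeas (-1) (by simp)) ⟨1 / 2, 1 / 2, by norm_num, by norm_num,
    by norm_num, by
      funext e
      simp only [Pi.add_apply, Pi.smul_apply, smul_eq_mul]
      ring⟩
  funext e
  have := congrFun this e
  simp only [one_mul, add_eq_left, mul_eq_zero, hε.ne', false_or] at this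
  exact this

open scoped Classical in
/-- An extreme point of the subtour relaxation has at most `2 n - 2` positive coordinates. -/
theorem card_edgeFinset_le_of_extreme [Nonempty V] {x : Sym2 V → ℝ}
    (hx : x ∈ (heldKarpFeasible G).extremePoints ℝ) (hpos : ∀ e ∈ G.edgeSet, 0 < x e) :
    G.edgeFinset.card + 2 ≤ 2 * Fintype.card V := by
  obtain ⟨r⟩ := ‹Nonempty V›
  have : Nonempty V := ⟨r⟩
  obtain ⟨s, hs, hspan⟩ := exists_spanning_of_intersecting _ V rfl
    {S | S.Nonempty ∧ r ∉ S ∧ ∑ e ∈ edgeCut G S, x e = 2} (cutVector G) (fun S hS => hS.1)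
    (by
      rintro S ⟨hS, hrS, hS2⟩ T ⟨hT, hrT, hT2⟩ hST
      have hr : r ∉ S ∪ T := by simp [hrS, hrT]
      obtain ⟨h1, h2, h3⟩ := cutVector_modular hx.1 hpos hS2 hT2 hST
        (fun h => hr (h ▸ Set.mem_univ r))
      exact ⟨⟨hST, fun h => hrS h.1, h1⟩,
        ⟨hST.mono (Set.inter_subset_left.trans Set.subset_union_left), hr, h2⟩, h3⟩)
  -- At most `n - 1` vectors from uncrossing and `n - 1` singleton cuts. Restricting to sets that
  -- avoid `r` keeps every union proper.
  set t : Finset (Sym2 V → ℝ) := s ∪ (univ.erase r).image fun v => cutVector G {v} with ht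
  have htc : t.card + 2 ≤ 2 * Fintype.card V := by
    have h2 := card_image_le (s := univ.erase r) (f := fun v => cutVector G {v})
    rw [card_erase_of_mem (mem_univ r), card_univ] at h2
    have h3 := Fintype.card_pos (α := V)
    refine (Nat.add_le_add_right (card_union_le _ _) 2).trans ?_
    omega
  by_contra hlt
  have hlt : t.card < G.edgeFinset.card := by omega
  -- With more edges than vectors in `t`, some nonzero `d` on the edges is orthogonal to all of `t`,
  -- hence to every tight cut, contradicting extremality.
  let L : (G.edgeFinset → ℝ) →ₗ[ℝ] (t → ℝ) :=
    LinearMap.pi fun m => ∑ e : G.edgeFinset, (m.1 e.1) • LinearMap.proj e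
  have hker : LinearMap.ker L ≠ ⊥ := LinearMap.ker_ne_bot_of_finrank_lt (by
    rwa [Module.finrank_fintype_fun_eq_card, Module.finrank_fintype_fun_eq_card, Fintype.card_coe,
      Fintype.card_coe])
  obtain ⟨d, hd, hd0⟩ := Submodule.exists_mem_ne_zero_of_ne_bot hker
  let d' : Sym2 V → ℝ := fun e => if h : e ∈ G.edgeFinset then d ⟨e, h⟩ else 0
  have hd' : ∀ m : Sym2 V → ℝ, ∑ e, m e * d' e = ∑ e : G.edgeFinset, m e.1 * d e := by
    intro m
    rw [← sum_subset (subset_univ G.edgeFinset) (fun e _ he => by simp only [d', dif_neg he,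
      mul_zero]), ← sum_coe_sort]
    refine sum_congr rfl fun e _ => ?_
    simp only [d', dif_pos e.2]
  let P : (Sym2 V → ℝ) →ₗ[ℝ] ℝ := ∑ e, d' e • LinearMap.proj e
  have hP : ∀ m, P m = ∑ e, m e * d' e := fun m => by simp [P, mul_comm]
  have htP : ∀ m ∈ t, P m = 0 := by
    intro m hm
    have := congrFun (LinearMap.mem_ker.1 hd) ⟨m, hm⟩
    rw [hP, hd']
    simpa [L] using this
  have hcut : ∀ S : Set V, S.Nonempty → r ∉ S → ∑ e ∈ edgeCut G S, x e = 2 →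
      ∑ e ∈ edgeCut G S, d' e = 0 := by
    intro S hS hrS hS2
    rw [sum_edgeCut_eq, ← hP, ← LinearMap.mem_ker]
    refine (Submodule.span_le.2 ?_) (hspan S ⟨hS, hrS, hS2⟩)
    rintro m (hm | ⟨v, ⟨-, hv, -⟩, rfl⟩)
    · exact htP m (mem_union_left _ hm)
    · exact htP _ (mem_union_right _ (mem_image_of_mem _
        (mem_erase.2 ⟨fun h => hv (by simp [h]), mem_univ v⟩)))
  have hz : d' = 0 := by
    refine eq_zero_of_extreme hx hpos (fun e he => dif_neg (by simpa using he)) ?_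
    intro S hS hS' hS2
    by_cases hr : r ∈ S
    · rw [← edgeCut_compl] at hS2 ⊢
      exact hcut Sᶜ (Set.nonempty_compl.2 hS') (fun h => h hr) hS2
    · exact hcut S hS hr hS2
  refine hd0 (funext fun e => ?_)
  have : d' e.1 = 0 := congrFun hz e.1
  rwa [show d' e.1 = d e from dif_pos e.2] at this

theorem optLP_eq {x : Sym2 V → ℝ} (hx : IsExtremeOptimal G x) : optLP G = lpValue G x :=
  IsLeast.csInf_eq ⟨⟨x, hx.1.1, rfl⟩, by
    rintro _ ⟨y, hy, rfl⟩
    exact hx.2 y hy⟩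

theorem sum_edgeCut_singleton (x : Sym2 V → ℝ) :
    ∑ v, ∑ e ∈ edgeCut G {v}, x e = 2 * lpValue G x := by
  classical
  have h : ∀ v, ∑ e ∈ edgeCut G {v}, x e = ∑ e ∈ G.edgeFinset, if v ∈ e then x e else 0 := by
    intro v
    rw [← sum_filter]
    refine sum_congr ?_ fun _ _ => rfl
    ext e
    induction e with
    | _ a b =>
      simp only [mk_mem_edgeCut, mem_filter, SimpleGraph.mem_edgeFinset, SimpleGraph.mem_edgeSet,
        Set.mem_singleton_iff, Sym2.mem_iff]
      refine and_congr_right fun hab => ?_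
      have := hab.ne
      grind
  simp only [h]
  rw [sum_comm, lpValue, mul_sum]
  refine sum_congr rfl fun e he => ?_
  rw [← sum_filter, sum_const, nsmul_eq_mul]
  congr 1
  induction e with
  | _ a b =>
    have hab : a ≠ b := (SimpleGraph.mem_edgeFinset.1 he : G.Adj a b).ne
    have : (univ.filter fun v => v ∈ s(a, b)) = {a, b} := by ext; simp
    rw [this, card_pair hab]
    norm_num

end CutLP

/-! ### Structure of greedy DFS trees -/

section Tree

/-- `A` is a tree rooted at `r` that spans `U`, and every tree-arc leaving `v` is at least as heavy
as all edges from `v` to the subtree below this arc. -/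
structure IsGreedyTree {V : Type*} (G : SimpleGraph V) (x : Sym2 V → ℝ) (r : V) (U : Set V)
    (A : Set (V × V)) : Prop where
  adj : ∀ v w, (v, w) ∈ A → G.Adj v w
  mem : ∀ v w, (v, w) ∈ A → v ∈ U ∧ w ∈ U
  root_mem : r ∈ U
  root : ∀ v, (v, r) ∉ A
  parent_unique : ∀ v v' w, (v, w) ∈ A → (v', w) ∈ A → v = v'
  exists_parent : ∀ w ∈ U, w ≠ r → ∃ v, (v, w) ∈ A
  exists_rank : ∃ t : V → ℕ, ∀ v w, (v, w) ∈ A → t v < t w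
  greedy : ∀ v w, (v, w) ∈ A → ∃ U' ⊆ U,
    (∀ w', G.Adj v w' → w' ∉ U' → x s(v, w') ≤ x s(v, w)) ∧ ∀ u, ArcReach A w u → u ∉ U'

variable {V : Type*} {G : SimpleGraph V} {x : Sym2 V → ℝ} {r : V} {A : Set (V × V)}

theorem IsGreedyTree.insert {U : Set V} (h : IsGreedyTree G x r U A) {v w : V} (hv : v ∈ U)
    (hvw : G.Adj v w) (hw : w ∉ U)
    (hmax : ∀ w', G.Adj v w' → w' ∉ U → x s(v, w') ≤ x s(v, w)) :
    IsGreedyTree G x r (insert w U) (insert (v, w) A) where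
  adj := by
    rintro a b (h1 | h1)
    · obtain ⟨rfl, rfl⟩ := Prod.mk.inj h1
      exact hvw
    · exact h.adj a b h1
  mem := by
    rintro a b (h1 | h1)
    · obtain ⟨rfl, rfl⟩ := Prod.mk.inj h1
      exact ⟨Or.inr hv, Or.inl rfl⟩
    · exact ⟨Or.inr (h.mem a b h1).1, Or.inr (h.mem a b h1).2⟩
  root_mem := Or.inr h.root_mem
  root := by
    rintro a (h1 | h1)
    · obtain ⟨rfl, rfl⟩ := Prod.mk.inj h1
      exact hw h.root_mem
    · exact h.root a h1
  parent_unique := by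
    rintro a a' b (h1 | h1) (h2 | h2)
    · exact (Prod.mk.inj h1).1.trans (Prod.mk.inj h2).1.symm
    · obtain ⟨rfl, rfl⟩ := Prod.mk.inj h1
      exact absurd (h.mem _ _ h2).2 hw
    · obtain ⟨rfl, rfl⟩ := Prod.mk.inj h2
      exact absurd (h.mem _ _ h1).2 hw
    · exact h.parent_unique _ _ _ h1 h2
  exists_parent := by
    rintro b (rfl | hb) hbr
    · exact ⟨v, Or.inl rfl⟩
    · obtain ⟨a, ha⟩ := h.exists_parent b hb hbr
      exact ⟨a, Or.inr ha⟩
  exists_rank := by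
    classical
    obtain ⟨t, ht⟩ := h.exists_rank
    have hne : ∀ a ∈ U, Function.update t w (t v + 1) a = t a := fun a ha =>
      Function.update_of_ne (by
        rintro rfl
        exact hw ha) _ _
    refine ⟨Function.update t w (t v + 1), ?_⟩
    rintro a b (h1 | h1)
    · obtain ⟨rfl, rfl⟩ := Prod.mk.inj h1
      rw [hne _ hv, Function.update_self]
      exact Nat.lt_succ_self _
    · rw [hne _ (h.mem a b h1).1, hne _ (h.mem a b h1).2]
      exact ht a b h1
  greedy := by
    have hreach : ∀ a u, ArcReach (Insert.insert (v, w) A) a u → ArcReach A a u ∨ u = w := by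
      intro a u hau
      induction hau with
      | refl => exact Or.inl .refl
      | tail _ hbc ih =>
        rcases hbc with h1 | h1
        · exact Or.inr (Prod.mk.inj h1).2
        · rcases ih with ih | rfl
          · exact Or.inl (ih.tail h1)
          · exact absurd (h.mem _ _ h1).1 hw
    rintro a b (h1 | h1)
    · obtain ⟨rfl, rfl⟩ := Prod.mk.inj h1
      -- The witness is the set visited when the arc was chosen. Older arcs keep their witness: the
      -- only possible new descendant `w` lies outside `U`, hence outside their `U'`.
      refine ⟨U, Set.subset_insert _ _, hmax, fun u hu => ?_⟩
      rcases hreach _ _ hu with h2 | rfl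
      · rcases h2.cases_head with rfl | ⟨c, hc, -⟩
        · exact hw
        · exact absurd (h.mem _ _ hc).1 hw
      · exact hw
    · obtain ⟨U', hU', h2, h3⟩ := h.greedy a b h1
      refine ⟨U', hU'.trans (Set.subset_insert _ _), h2, fun u hu => ?_⟩
      rcases hreach _ _ hu with h4 | rfl
      · exact h3 u h4
      · exact fun hu => hw (hU' hu)

/-- The last clause is the invariant that makes the final tree spanning: once the stack is empty,
the visited set is closed under adjacency. -/
theorem GreedyDFS.isGreedyTree {s : List V} {U : Set V} (h : GreedyDFS G x r s U A) :
    IsGreedyTree G x r U A ∧ (∀ v ∈ s, v ∈ U) ∧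
      ∀ u ∈ U, u ∉ s → ∀ w, G.Adj u w → w ∈ U := by
  induction h with
  | start =>
    refine ⟨⟨by simp, by simp, rfl, by simp, by simp, ?_, ⟨fun _ => 0, by simp⟩, by simp⟩,
      by simp, ?_⟩
    · rintro w rfl h
      exact absurd rfl h
    · rintro u rfl h
      simp at h
  | forward _ hvw hw hmax ih =>
    obtain ⟨h1, h2, h3⟩ := ih
    refine ⟨h1.insert (h2 _ (by simp)) hvw hw hmax, ?_, ?_⟩
    · intro a ha
      rcases List.mem_cons.1 ha with rfl | ha
      · exact Or.inl rfl
      · exact Or.inr (h2 a ha)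
    · rintro u (rfl | hu) hus b hb
      · simp at hus
      · exact Or.inr (h3 u hu (fun h => hus (List.mem_cons_of_mem _ h)) b hb)
  | @backtrack v s _ _ _ hv ih =>
    obtain ⟨h1, h2, h3⟩ := ih
    refine ⟨h1, fun a ha => h2 a (List.mem_cons_of_mem _ ha), fun u hu hus b hb => ?_⟩
    by_cases huv : u ∈ v :: s
    · rcases List.mem_cons.1 huv with rfl | h
      · exact hv b hb
      · exact absurd h hus
    · exact h3 u hu huv b hb

theorem IsGreedyDFSTree.isGreedyTree (h : IsGreedyDFSTree G x r A) (hG : G.Connected) :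
    IsGreedyTree G x r Set.univ A := by
  obtain ⟨U, hU⟩ := h
  obtain ⟨h1, -, h3⟩ := hU.isGreedyTree
  have : U = Set.univ := by
    refine Set.eq_univ_of_forall fun v => ?_
    obtain ⟨p⟩ := hG.preconnected r v
    have : ∀ a b, G.Walk a b → a ∈ U → b ∈ U := by
      intro a b p
      induction p with
      | nil => exact id
      | cons hab _ ih => exact fun ha => ih (h3 _ ha List.not_mem_nil _ hab)
    exact this r v p h1.root_mem
  exact this ▸ h1

namespace IsGreedyTree

variable {U : Set V}

theorem le_of_arcReach (h : IsGreedyTree G x r U A) {v w u : V} (hvw : (v, w) ∈ A)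
    (hwu : ArcReach A w u) (hvu : G.Adj v u) : x s(v, u) ≤ x s(v, w) := by
  obtain ⟨U', -, h1, h2⟩ := h.greedy v w hvw
  exact h1 u hvu (h2 u hwu)

theorem not_arc_of_arcReach (h : IsGreedyTree G x r U A) {v w : V} (hvw : ArcReach A v w) :
    (w, v) ∉ A := by
  obtain ⟨t, ht⟩ := h.exists_rank
  have : t v ≤ t w := by
    induction hvw with
    | refl => exact le_rfl
    | tail _ hbc ih => exact ih.trans (ht _ _ hbc).le
  exact fun hwv => (ht _ _ hwv).not_ge this

theorem arcReach_antisymm (h : IsGreedyTree G x r U A) {v w : V} (hvw : ArcReach A v w)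
    (hwv : ArcReach A w v) : v = w := by
  rcases hvw.cases_tail with h1 | ⟨b, hb, hbw⟩
  · exact h1.symm
  · exact absurd hbw (h.not_arc_of_arcReach (hwv.trans hb))

/-- Every vertex lies below at most one child of a given vertex. -/
theorem child_unique (h : IsGreedyTree G x r U A) {v w w' u : V} (hw : (v, w) ∈ A)
    (hw' : (v, w') ∈ A) (hu : ArcReach A w u) (hu' : ArcReach A w' u) : w = w' := by
  have aux : ∀ w w', (v, w) ∈ A → (v, w') ∈ A → ArcReach A w w' → w = w' := by
    intro w w' hw hw' hww'
    rcases hww'.cases_tail with h1 | ⟨b, hb, hbw⟩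
    · exact h1.symm
    · obtain rfl := h.parent_unique _ _ _ hbw hw'
      exact absurd hw (h.not_arc_of_arcReach hb)
  -- Parents are unique, so the ancestors of `u` form a chain.
  have hswap := Relation.ReflTransGen.total_of_right_unique
    (r := Function.swap fun a b => (a, b) ∈ A)
    (fun a b c hab hac => h.parent_unique _ _ _ hab hac)
    (Relation.reflTransGen_swap.2 hu) (Relation.reflTransGen_swap.2 hu')
  rcases hswap with h1 | h1
  · exact (aux _ _ hw' hw (Relation.reflTransGen_swap.1 h1)).symm
  · exact aux _ _ hw hw' (Relation.reflTransGen_swap.1 h1)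

end IsGreedyTree

end Tree

/-! ### Back-arcs and the cost at one vertex -/

section Network

open Finset

open scoped Classical in
/-- The in-vertex of the network on the tree-arc `(v, w)`. -/
noncomputable def arcInVertex {V : Type*} (r v w : V) : NetVertex V :=
  if v = r then Sum.inl v else Sum.inr (v, w)

theorem base_arcInVertex {V : Type*} (r v w : V) : (arcInVertex r v w).base = v := by
  unfold arcInVertex
  split_ifs <;> rfl

theorem backArcEdge_eq {V : Type*} {r : V} (u v w : V) :
    backArcEdge ((Sum.inl u, arcInVertex r v w) : NetVertex V × NetVertex V) = s(u, v) := by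
  rw [backArcEdge, base_arcInVertex]
  rfl

variable {V : Type*} [Fintype V] {G : SimpleGraph V} {x : Sym2 V → ℝ} {r : V} {A : Set (V × V)}
  {U : Set V}

theorem exists_of_mem_netBackArcs {a : NetVertex V × NetVertex V} (ha : a ∈ netBackArcs G r A) :
    ∃ u v w, IsBackArc G A u v ∧ (v, w) ∈ A ∧ ArcReach A w u ∧
      a = (Sum.inl u, arcInVertex r v w) := by
  classical
  rcases (mem_filter.1 ha).2 with ⟨u, hu, rfl⟩ | ⟨u, v, w, hu, hv, hvw, hwu, rfl⟩
  · rcases hu.2.2.2.cases_head with h1 | ⟨w, hw, hwu⟩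
    · exact absurd h1.symm hu.1.ne
    · exact ⟨u, r, w, hu, hw, hwu, by simp [arcInVertex]⟩
  · exact ⟨u, v, w, hu, hvw, hwu, by simp [arcInVertex, hv]⟩

namespace IsGreedyTree

/-- The ancestor relation fixes the direction of the edge, and the child above the tail fixes the
in-vertex to which it is redirected. -/
theorem injOn_backArcEdge (h : IsGreedyTree G x r U A) :
    Set.InjOn backArcEdge (netBackArcs G r A : Set (NetVertex V × NetVertex V)) := by
  intro a ha b hb hab
  obtain ⟨u, v, w, h1, hvw, hwu, rfl⟩ := exists_of_mem_netBackArcs (mem_coe.1 ha)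
  obtain ⟨u', v', w', h1', hvw', hwu', rfl⟩ := exists_of_mem_netBackArcs (mem_coe.1 hb)
  rw [backArcEdge_eq, backArcEdge_eq, Sym2.eq_iff] at hab
  rcases hab with ⟨rfl, rfl⟩ | ⟨rfl, rfl⟩
  · rw [h.child_unique hvw hvw' hwu hwu']
  · exact absurd (h.arcReach_antisymm h1.2.2.2 h1'.2.2.2) h1.1.ne'

-- Sending each non-root vertex to its parent edge yields `n - 1` edges that no back-arc uses.
open scoped Classical in
theorem card_netBackArcs_le (h : IsGreedyTree G x r Set.univ A) :
    (netBackArcs G r A).card + (Fintype.card V - 1) ≤ G.edgeFinset.card := by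
  choose! par hpar using fun w => h.exists_parent w (Set.mem_univ w)
  obtain ⟨t, ht⟩ := h.exists_rank
  -- The rank excludes two vertices that are each other's parent.
  have hinj : Set.InjOn (fun w => s(par w, w)) (univ.erase r : Finset V) := by
    intro w hw w' hw' hww'
    have h1 := ht _ _ (hpar w (mem_erase.1 (mem_coe.1 hw)).1)
    have h2 := ht _ _ (hpar w' (mem_erase.1 (mem_coe.1 hw')).1)
    rcases Sym2.eq_iff.1 hww' with ⟨-, h3⟩ | ⟨h3, h4⟩
    · exact h3
    · rw [h3] at h1
      rw [← h4] at h2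
      omega
  have hdisj : Disjoint ((netBackArcs G r A).image backArcEdge)
      ((univ.erase r).image fun w => s(par w, w)) := by
    rw [disjoint_left]
    intro e he he'
    obtain ⟨a, ha, rfl⟩ := mem_image.1 he
    obtain ⟨w, hw, hwe⟩ := mem_image.1 he'
    obtain ⟨u, v, _, h1, -, -, rfl⟩ := exists_of_mem_netBackArcs ha
    have hp := hpar w (mem_erase.1 hw).1
    rw [backArcEdge_eq, Sym2.eq_iff] at hwe
    rcases hwe with ⟨h3, h4⟩ | ⟨h3, h4⟩ <;> rw [h3, h4] at hp
    exacts [h1.2.1 hp, h1.2.2.1 hp]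
  rw [← card_univ, ← card_erase_of_mem (mem_univ r), ← card_image_of_injOn hinj,
    ← card_image_of_injOn h.injOn_backArcEdge, ← card_union_of_disjoint hdisj]
  refine card_le_card (union_subset ?_ ?_)
  · intro e he
    obtain ⟨a, ha, rfl⟩ := mem_image.1 he
    obtain ⟨u, v, _, h1, -, -, rfl⟩ := exists_of_mem_netBackArcs ha
    rw [backArcEdge_eq, SimpleGraph.mem_edgeFinset]
    exact h1.1
  · intro e he
    obtain ⟨w, hw, rfl⟩ := mem_image.1 he
    rw [SimpleGraph.mem_edgeFinset]
    exact h.adj _ _ (hpar w (mem_erase.1 hw).1)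

/-- A back-arc is never a tree-arc, so the only fundamental cycle through it is its own. -/
theorem coreCirculation_eq (h : IsGreedyTree G x r U A) {a : NetVertex V × NetVertex V}
    (ha : a ∈ netBackArcs G r A) : coreCirculation G x r A a = min (x (backArcEdge a)) 1 := by
  have hna : a ∉ netTreeArcs r A := by
    obtain ⟨u, v, w, h1, hvw, -, rfl⟩ := exists_of_mem_netBackArcs ha
    rintro (⟨w', hw', h2⟩ | ⟨v', w', hw', hv', h2 | h2⟩)
    · have h3 := congrArg NetVertex.base (Prod.mk.inj h2).1
      have h4 := congrArg NetVertex.base (Prod.mk.inj h2).2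
      rw [base_arcInVertex] at h4
      obtain rfl : u = r := h3
      obtain rfl : v = w' := h4
      exact h1.2.1 hw'
    · have h3 := congrArg NetVertex.base (Prod.mk.inj h2).1
      have h4 := congrArg NetVertex.base (Prod.mk.inj h2).2
      rw [base_arcInVertex] at h4
      obtain rfl : u = v' := h3
      obtain rfl : v = u := h4
      exact h1.1.ne rfl
    · cases (Prod.mk.inj h2).1
  rw [coreCirculation, sum_eq_single a]
  · exact if_pos (Or.inl rfl)
  · exact fun b _ hb => if_neg (by
      rintro (h1 | h1)
      exacts [hb h1.symm, hna h1.1])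
  · exact fun h => absurd ha h

end IsGreedyTree

/-- Superadditivity of `max (y - 2) 0` on nonnegative reals; it merges the in-vertices of one
gadget. -/
theorem sum_max_sub_two_le {ι : Type*} (s : Finset ι) (Y : ι → ℝ) (hY : ∀ i ∈ s, 0 ≤ Y i) :
    ∑ i ∈ s, max (Y i - 2) 0 ≤ max (∑ i ∈ s, Y i - 2) 0 := by
  classical
  induction s using Finset.induction_on with
  | empty => simp
  | insert i s hi ih =>
    rw [sum_insert hi, sum_insert hi]
    have h1 := ih fun j hj => hY j (mem_insert_of_mem hj)
    have h2 := hY i (mem_insert_self i s)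
    have h3 := sum_nonneg fun j hj => hY j (mem_insert_of_mem hj)
    rcases max_cases (Y i - 2) 0 with h4 | h4 <;>
      rcases max_cases (∑ i ∈ s, Y i - 2) 0 with h5 | h5 <;>
      rcases max_cases (Y i + ∑ i ∈ s, Y i - 2) 0 with h6 | h6 <;> linarith

/-- The bound on the excess `B - 1` of the flow `B` on `k` back-arcs in terms of the total value
`Y` of these arcs and a tree-arc of value `T` that is at least as heavy as each of them. -/
theorem excess_le {k : ℕ} {B T Y : ℝ} (hk : 1 ≤ k) (h1 : B ≤ k) (h2 : B ≤ k * T)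
    (h3 : B + T ≤ Y) : max (B - 1) 0 ≤ 5 / 6 * max (Y - 2) 0 + (k : ℝ) / 6 := by
  have hY := le_max_left (Y - 2) 0
  have hY0 := le_max_right (Y - 2) 0
  have hk0 : (1 : ℝ) ≤ k := by exact_mod_cast hk
  refine max_le ?_ (by positivity)
  rcases hk.eq_or_lt with rfl | hk2
  · norm_num at h1 ⊢
    linarith
  have hk2 : (2 : ℝ) ≤ k := by exact_mod_cast hk2
  -- Integrality of `k` enters here. The final bound is tight at `k = 2` and `k = 3`, which is where
  -- the constants 5/6 and 1/6 come from.
  have hkk : (0 : ℝ) ≤ (k - 2) * (k - 3) := by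
    rcases Nat.lt_or_ge k 3 with h | h
    · have : (k : ℝ) = 2 := by
        have : k = 2 := by
          have : 2 ≤ k := by exact_mod_cast hk2
          omega
        exact_mod_cast this
      simp [this]
    · have : (3 : ℝ) ≤ k := by exact_mod_cast h
      exact mul_nonneg (by linarith) (by linarith)
  -- Since `T ≥ B / k`, one has `Y ≥ (k + 1) * B / k`; the split is at the value of `B` where this
  -- bound reaches 2. Below it, `B - 1 ≤ (k - 1) / (k + 1) ≤ k / 6`, the last step being `hkk`.
  rcases le_total ((k + 1) * B) (2 * k) with h | h
  · suffices (k + 1) * (B - 1) ≤ (k + 1) * (k / 6 : ℝ) by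
      have := le_of_mul_le_mul_left this (by linarith)
      linarith
    nlinarith
  · suffices k * (B - 1) ≤ k * (5 / 6 * (Y - 2) + k / 6 : ℝ) by
      have := le_of_mul_le_mul_left this (by linarith)
      linarith
    have h4 : (k + 1) * B ≤ k * Y := by nlinarith
    suffices k * (B - 1) ≤ 5 / 6 * ((k + 1) * B - 2 * k) + k * k / 6 by nlinarith
    -- The goal amounts to `(k - 5) * B ≤ k * (k - 4)`, so the sign of `k - 5` decides whether the
    -- lower or the upper bound on `B` is critical.
    rcases le_total (k : ℝ) 5 with h5 | h5
    · nlinarith [mul_nonneg (sub_nonneg.2 h5) (sub_nonneg.2 h1)]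
    · nlinarith

open scoped Classical in
/-- The cost of the in-vertices in the gadget of a vertex `v`. -/
theorem sum_excess_le (hx : x ∈ heldKarpFeasible G) (hV : 2 ≤ Fintype.card V)
    (h : IsGreedyTree G x r U A) (v : V) :
    ∑ p ∈ inVertices r A with p.base = v,
        max ((∑ a ∈ netBackArcs G r A with a.2 = p, coreCirculation G x r A a) - 1) 0 ≤
      5 / 6 * (∑ e ∈ edgeCut G {v}, x e - 2) +
        (((netBackArcs G r A).filter fun a => a.2.base = v).card : ℝ) / 6 := by
  set Q : NetVertex V → Finset (NetVertex V × NetVertex V) :=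
    fun p => (netBackArcs G r A).filter fun a => a.2 = p with hQ
  have hdeg : 2 ≤ ∑ e ∈ edgeCut G {v}, x e := by
    refine hx.2.2 {v} (Set.singleton_nonempty v) fun hv => ?_
    have : Fintype.card V ≤ 1 := Fintype.card_le_one_iff_subsingleton.2
      ((Set.subsingleton_univ_iff).1 (hv ▸ Set.subsingleton_singleton))
    omega
  have hτ : ∀ p, (Q p).Nonempty → ∃ w, (p.base, w) ∈ A ∧ arcInVertex r p.base w = p ∧
      ∀ a ∈ Q p, x (backArcEdge a) ≤ x s(p.base, w) := by
    rintro p ⟨a, ha⟩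
    obtain ⟨u, v, w, h1, hvw, -, rfl⟩ := exists_of_mem_netBackArcs (mem_filter.1 ha).1
    obtain rfl := (mem_filter.1 ha).2
    simp only [base_arcInVertex]
    -- All children of the root share one in-vertex, so the heaviest tree-arc belonging to the
    -- in-vertex is taken; elsewhere there is only one.
    obtain ⟨m, hm, hmax⟩ := exists_max_image
      (univ.filter fun w' => (v, w') ∈ A ∧ arcInVertex r v w' = arcInVertex r v w)
      (fun w' => x s(v, w')) ⟨w, by simp [hvw]⟩
    refine ⟨m, (mem_filter.1 hm).2.1, (mem_filter.1 hm).2.2, fun b hb => ?_⟩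
    obtain ⟨u', v', w', h1', hvw', hwu', rfl⟩ := exists_of_mem_netBackArcs (mem_filter.1 hb).1
    have hp : arcInVertex r v' w' = arcInVertex r v w := (mem_filter.1 hb).2
    obtain rfl : v' = v := by
      have := congrArg NetVertex.base hp
      rwa [base_arcInVertex, base_arcInVertex] at this
    rw [backArcEdge_eq, Sym2.eq_swap]
    exact (h.le_of_arcReach hvw' hwu' h1'.1.symm).trans
      (hmax w' (mem_filter.2 ⟨mem_univ _, hvw', hp⟩))
  have : Nonempty V := ⟨v⟩
  choose! τ hτA hτp hτx using hτ
  set P := (inVertices r A).filter fun p => p.base = v ∧ (Q p).Nonempty with hP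
  have hPb : ∀ p ∈ P, p.base = v ∧ (Q p).Nonempty := fun p hp => (mem_filter.1 hp).2
  have hcost : ∑ p ∈ inVertices r A with p.base = v,
      max ((∑ a ∈ Q p, coreCirculation G x r A a) - 1) 0 =
      ∑ p ∈ P, max ((∑ a ∈ Q p, coreCirculation G x r A a) - 1) 0 := by
    symm
    refine sum_subset (fun p hp => ?_) (fun p hp hpP => ?_)
    · exact mem_filter.2 ⟨(mem_filter.1 hp).1, (hPb p hp).1⟩
    · have : Q p = ∅ := by
        by_contra hne
        exact hpP (mem_filter.2 ⟨(mem_filter.1 hp).1, (mem_filter.1 hp).2,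
          nonempty_iff_ne_empty.2 hne⟩)
      simp [this]
  set Y : NetVertex V → ℝ := fun p => ∑ a ∈ Q p, x (backArcEdge a) + x s(v, τ p) with hY
  have hlocal : ∀ p ∈ P, max ((∑ a ∈ Q p, coreCirculation G x r A a) - 1) 0 ≤
      5 / 6 * max (Y p - 2) 0 + ((Q p).card : ℝ) / 6 := by
    intro p hp
    obtain ⟨hb, hne⟩ := hPb p hp
    have hf : ∀ a ∈ Q p, coreCirculation G x r A a = min (x (backArcEdge a)) 1 := fun a ha =>
      h.coreCirculation_eq (mem_filter.1 ha).1
    refine excess_le (T := x s(v, τ p)) (card_pos.2 hne) ?_ ?_ ?_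
    · rw [← nsmul_one]
      exact sum_le_card_nsmul _ _ _ fun a ha => (hf a ha).trans_le (min_le_right _ _)
    · rw [← nsmul_eq_mul]
      refine sum_le_card_nsmul _ _ _ fun a ha => (hf a ha).trans_le ((min_le_left _ _).trans ?_)
      have := hτx p hne a ha
      rwa [hb] at this
    · exact add_le_add_left (sum_le_sum fun a ha => (hf a ha).trans_le (min_le_left _ _)) _
  -- The back-arcs and the chosen tree-arcs `(v, τ p)` correspond to pairwise distinct edges at `v`.
  have hsumY : ∑ p ∈ P, Y p ≤ ∑ e ∈ edgeCut G {v}, x e := by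
    set R := (netBackArcs G r A).filter fun a => a.2 ∈ P with hR
    have hRB : ∀ a ∈ R, a ∈ netBackArcs G r A := fun a ha => (mem_filter.1 ha).1
    have hRu : ∀ a ∈ R, ∃ u, IsBackArc G A u v ∧ backArcEdge a = s(u, v) := by
      intro a ha
      have h2 := (hPb _ (mem_filter.1 ha).2).1
      obtain ⟨u, v', w, h1, -, -, rfl⟩ := exists_of_mem_netBackArcs (hRB a ha)
      obtain rfl : v' = v := by
        rw [← h2]
        exact (base_arcInVertex r v' w).symm
      exact ⟨u, h1, backArcEdge_eq _ _ _⟩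
    have hPA : ∀ p ∈ P, (v, τ p) ∈ A := fun p hp => by
      have := hτA p (hPb p hp).2
      rwa [(hPb p hp).1] at this
    have hinj : Set.InjOn (fun p => s(v, τ p)) (P : Set (NetVertex V)) := by
      intro p hp p' hp' hpp'
      have h1 := hτp p (hPb p hp).2
      have h2 := hτp p' (hPb p' hp').2
      rw [(hPb p hp).1] at h1
      rw [(hPb p' hp').1] at h2
      rw [← h1, ← h2, Sym2.congr_right.1 hpp']
    have hdisj : Disjoint (R.image backArcEdge) (P.image fun p => s(v, τ p)) := by
      rw [disjoint_left]
      intro e he he'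
      obtain ⟨a, ha, rfl⟩ := mem_image.1 he
      obtain ⟨p, hp, hpe⟩ := mem_image.1 he'
      obtain ⟨u, h1, h2⟩ := hRu a ha
      have h3 := hPA p hp
      rw [h2, Sym2.eq_swap, Sym2.congr_left] at hpe
      exact h1.2.2.1 (hpe ▸ h3)
    have hsub : R.image backArcEdge ∪ P.image (fun p => s(v, τ p)) ⊆ edgeCut G {v} := by
      refine union_subset (fun e he => ?_) (fun e he => ?_)
      · obtain ⟨a, ha, rfl⟩ := mem_image.1 he
        obtain ⟨u, h1, h2⟩ := hRu a ha
        rw [h2, mk_mem_edgeCut]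
        exact ⟨h1.1, Or.inr ⟨rfl, h1.1.ne⟩⟩
      · obtain ⟨p, hp, rfl⟩ := mem_image.1 he
        have h1 := h.adj _ _ (hPA p hp)
        exact mk_mem_edgeCut.2 ⟨h1, Or.inl ⟨rfl, h1.ne'⟩⟩
    calc ∑ p ∈ P, Y p
        = ∑ a ∈ R, x (backArcEdge a) + ∑ p ∈ P, x s(v, τ p) := by
          rw [hY, sum_add_distrib, sum_fiberwise_eq_sum_filter]
      _ = ∑ e ∈ R.image backArcEdge ∪ P.image (fun p => s(v, τ p)), x e := by
          rw [sum_union hdisj, sum_image (h.injOn_backArcEdge.mono fun a ha => hRB a ha),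
            sum_image hinj]
      _ ≤ ∑ e ∈ edgeCut G {v}, x e := sum_le_sum_of_subset_of_nonneg hsub fun e _ _ => hx.1 e
  have hcard : ∑ p ∈ P, ((Q p).card : ℝ) ≤
      (((netBackArcs G r A).filter fun a => a.2.base = v).card : ℝ) := by
    have : ∑ p ∈ P, (Q p).card = ((netBackArcs G r A).filter fun a => a.2 ∈ P).card := by
      simp only [card_eq_sum_ones, hQ]
      rw [sum_fiberwise_eq_sum_filter]
    rw [← Nat.cast_sum, this, Nat.cast_le]
    exact card_le_card fun a ha => mem_filter.2
      ⟨(mem_filter.1 ha).1, (hPb _ (mem_filter.1 ha).2).1⟩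
  have hYmax := sum_max_sub_two_le P Y fun p _ =>
    add_nonneg (sum_nonneg fun a _ => hx.1 _) (hx.1 _)
  -- The zero branch is where the degree constraint `x(δ(v)) ≥ 2` is needed.
  have hYv : max (∑ p ∈ P, Y p - 2) 0 ≤ ∑ e ∈ edgeCut G {v}, x e - 2 :=
    max_le (by linarith) (by linarith)
  have htotal := sum_le_sum hlocal
  rw [sum_add_distrib, ← mul_sum, ← sum_div] at htotal
  rw [hcost]
  linarith

open scoped Classical in
theorem circulationCost_eq (f : NetVertex V × NetVertex V → ℝ) :
    circulationCost G r A f = ∑ v, ∑ p ∈ inVertices r A with p.base = v,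
      max ((∑ a ∈ netBackArcs G r A with a.2 = p, f a) - 1) 0 :=
  (sum_fiberwise _ _ _).symm

end Network

/-! ### Summation over all vertices -/

theorem mainTheorem4 {V : Type*} [Fintype V] (G : SimpleGraph V) (hG : IsTwoVertexConnected G)
    (x : Sym2 V → ℝ) (hx : IsExtremeOptimal G x) (hpos : ∀ e ∈ G.edgeSet, 0 < x e)
    (r : V) (A : Set (V × V)) (hA : IsGreedyDFSTree G x r A) :
    circulationCost G r A (coreCirculation G x r A) ≤
      (5 / 3 : ℝ) * optLP G - (3 / 2 : ℝ) * (Fintype.card V : ℝ) := by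
  classical
  have : Nonempty V := ⟨r⟩
  have hT := hA.isGreedyTree hG.2.1
  have hback : ((netBackArcs G r A).card : ℝ) ≤ Fintype.card V := by
    have h1 := hT.card_netBackArcs_le
    have h2 := card_edgeFinset_le_of_extreme hx.1 hpos
    have h3 := hG.1
    have : (netBackArcs G r A).card ≤ Fintype.card V := by omega
    exact_mod_cast this
  have hsum := Finset.sum_le_sum fun v (_ : v ∈ Finset.univ) =>
    sum_excess_le hx.1.1 hG.1 hT v
  rw [← circulationCost_eq, Finset.sum_add_distrib, ← Finset.mul_sum, Finset.sum_sub_distrib,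
    sum_edgeCut_singleton, ← Finset.sum_div, ← Nat.cast_sum] at hsum
  have hcard : ∑ v, ((netBackArcs G r A).filter fun a => a.2.base = v).card =
      (netBackArcs G r A).card :=
    (Finset.card_eq_sum_card_fiberwise fun a _ => Finset.mem_coe.2 (Finset.mem_univ _)).symm
  rw [hcard, Finset.sum_const, Finset.card_univ, nsmul_eq_mul] at hsum
  rw [optLP_eq hx]
  refine hsum.trans ?_
  -- `5/6 * (2 * OPT - 2 * n) + n/6 = 5/3 * OPT - 3/2 * n`.
  linarith
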